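/- Let $(X,S)$ be a finite association scheme (not necessarily commutative or symmetric): $X$ is a finite set and $S=\{R_0,\dots,R_d\}$ is a partition of $X\times X$ into nonempty relations such that $R_0$ is the diagonal, the transpose of each $R_i$ is again some $R_j$, and for all $i,j,k$ the number of $w\in X$ with $(u,w)\in R_i$ and $(w,v)\in R_j$ is the same for all $(u,v)\in R_k$. Let $A_i$ be the adjacency matrix of $R_i$, let $x\in X$, and let $E_i^*$ be the diagonal matrix with $(E_i^*)_{uu}=(A_i)_{xu}$ for $u \in X$. Let $T_x\subseteq M_X(\mathbb{C})$ be the $\mathbb{C}$-algebra, and $\mathbb{Q}T_x\subseteq M_X(\mathbb{Q})$ the $\mathbb{Q}$-algebra, generated by $A_0,\dots,A_d,E_0^*,\dots,E_d^*$; thus $T_x\cong\mathbb{C}\otimes_{\mathbb{Q}}\mathbb{Q}T_x$. Let $V$ be an irreducible $T_x$-module which is thin, that is, $\dim_{\mathbb{C}} E_i^*V\le 1$ for all $i$. Let $\chi$ be its character, let $\mathbb{Q}(\chi)\subseteq\mathbb{C}$ be the field generated over $\mathbb{Q}$ by the values $\chi(a)$, $a\in\mathbb{Q}T_x$, and let $d'$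 be the dual diameter of $V$, that is, the number of indices $i$ with $E_i^*V\neq 0$. Then: 1. There is a unique centrally primitive idempotent $e$ of $\mathbb{Q}T_x$ with $eV\ne 0$ (so that $\mathbb{Q}T_xe$ is the simple component of $\mathbb{Q}T_x$ determined by $V$ and $\chi$). 2. The rational Schur index of $\chi$ is $1$: there is an irreducible $\mathbb{Q}T_x$-module $W$ with $eW\neq 0$, and for every such $W$ the multiplicity of $V$ in the $T_x$-module $\mathbb{C}\otimes_{\mathbb{Q}}W$ is $1$. 3. $\mathbb{Q}T_xe\cong M_{d'}(\mathbb{Q}(\chi))$ as $\mathbb{Q}$-algebras. -/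

import Mathlib

open scoped TensorProduct

universe u v w

noncomputable section

/-- A (finite, not necessarily symmetric or commutative) association scheme with `d` classes on the
vertex set `X`. The function `rel` sends a pair `(u, v)` to the index of the unique relation which
contains it, so that the relations `R_i = {(u, v) | rel u v = i}` partition `X × X`. -/
structure AssociationScheme (X : Type*) [Fintype X] (d : ℕ) where
  rel : X → X → Fin (d + 1)
  /-- Every relation is nonempty. -/
  exists_rel : ∀ i, ∃ u v, rel u v = i
  /-- `R_0` is the diagonal. -/
  rel_eq_zero_iff : ∀ u v, rel u v = 0 ↔ u = v
  /-- The transpose of a relation is a relation. -/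
  exists_transpose : ∀ i, ∃ j, ∀ u v, rel u v = i ↔ rel v u = j
  /-- Existence of the intersection numbers. -/
  exists_intersection : ∀ i j k, ∃ p : ℕ, ∀ u v, rel u v = k →
    (Finset.univ.filter fun w => rel u w = i ∧ rel w v = j).card = p

namespace AssociationScheme

variable {X : Type*} [Fintype X] [DecidableEq X] {d : ℕ} (S : AssociationScheme X d)

/-- The adjacency matrix `A_i` with entries in `K`. -/
def adjMatrix (K : Type*) [Field K] (i : Fin (d + 1)) : Matrix X X K :=
  Matrix.of fun u v => if S.rel u v = i then 1 else 0

/-- The dual idempotent `E_i^*` with respect to `x`, with entries in `K`. -/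
def dualIdempotent (K : Type*) [Field K] (x : X) (i : Fin (d + 1)) : Matrix X X K :=
  Matrix.diagonal fun u => S.adjMatrix K i x u

/-- The Terwilliger algebra over `K` with respect to `x`, generated by the adjacency matrices and
the dual idempotents. The case `K = ℂ` is `T_x`, the case `K = ℚ` is `ℚT_x`. -/
def terwilligerAlgebra (K : Type*) [Field K] (x : X) : Subalgebra K (Matrix X X K) :=
  Algebra.adjoin K (Set.range (S.adjMatrix K) ∪ Set.range (S.dualIdempotent K x))

theorem adjMatrix_mem (K : Type*) [Field K] (x : X) (i : Fin (d + 1)) :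
    S.adjMatrix K i ∈ S.terwilligerAlgebra K x :=
  Algebra.subset_adjoin (Or.inl ⟨i, rfl⟩)

theorem dualIdempotent_mem (K : Type*) [Field K] (x : X) (i : Fin (d + 1)) :
    S.dualIdempotent K x i ∈ S.terwilligerAlgebra K x :=
  Algebra.subset_adjoin (Or.inr ⟨i, rfl⟩)

theorem map_adjMatrix (i : Fin (d + 1)) :
    (S.adjMatrix ℚ i).map (algebraMap ℚ ℂ) = S.adjMatrix ℂ i := by
  ext u v
  simp only [adjMatrix, Matrix.map_apply, Matrix.of_apply]
  split_ifs <;> simp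

theorem map_dualIdempotent (x : X) (i : Fin (d + 1)) :
    (S.dualIdempotent ℚ x i).map (algebraMap ℚ ℂ) = S.dualIdempotent ℂ x i := by
  rw [dualIdempotent, Matrix.diagonal_map (map_zero _), dualIdempotent, ← S.map_adjMatrix i]
  rfl

theorem map_mem (x : X) {a : Matrix X X ℚ} (ha : a ∈ S.terwilligerAlgebra ℚ x) :
    (Algebra.ofId ℚ ℂ).mapMatrix a ∈ S.terwilligerAlgebra ℂ x := by
  induction ha using Algebra.adjoin_induction with
  | mem a ha =>
    rcases ha with ⟨i, rfl⟩ | ⟨i, rfl⟩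
    · change (S.adjMatrix ℚ i).map (algebraMap ℚ ℂ) ∈ _
      exact S.map_adjMatrix i ▸ S.adjMatrix_mem ℂ x i
    · change (S.dualIdempotent ℚ x i).map (algebraMap ℚ ℂ) ∈ _
      exact S.map_dualIdempotent x i ▸ S.dualIdempotent_mem ℂ x i
  | algebraMap r =>
    rw [AlgHom.commutes]
    exact ((S.terwilligerAlgebra ℂ x).restrictScalars ℚ).algebraMap_mem r
  | add a b _ _ ha hb => rw [map_add]; exact Subalgebra.add_mem _ ha hb
  | mul a b _ _ ha hb => rw [map_mul]; exact Subalgebra.mul_mem _ ha hb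

/-- The inclusion `ℚT_x → T_x`, reading a rational matrix as a complex one. -/
def rationalInclusion (x : X) : S.terwilligerAlgebra ℚ x →ₐ[ℚ] S.terwilligerAlgebra ℂ x :=
  AlgHom.codRestrict ((Algebra.ofId ℚ ℂ).mapMatrix.comp (S.terwilligerAlgebra ℚ x).val)
    ((S.terwilligerAlgebra ℂ x).restrictScalars ℚ) fun a => S.map_mem x a.2

/-- The canonical map `ℂ ⊗ ℚT_x → T_x`, `c ⊗ a ↦ c a`. -/
def extensionHom (x : X) :
    ℂ ⊗[ℚ] S.terwilligerAlgebra ℚ x →ₐ[ℂ] S.terwilligerAlgebra ℂ x :=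
  Algebra.TensorProduct.lift (Algebra.ofId ℂ _) (S.rationalInclusion x)
    fun c _ => Algebra.commutes c _

theorem extensionHom_tmul (x : X) (c : ℂ) (a : S.terwilligerAlgebra ℚ x) :
    S.extensionHom x (c ⊗ₜ a) = c • S.rationalInclusion x a := by
  rw [Algebra.smul_def]
  exact Algebra.TensorProduct.lift_tmul _ _ _ c a

theorem extensionHom_bijective (x : X) : Function.Bijective (S.extensionHom x) := by
  constructor
  · have h : ∀ t, ((S.extensionHom x t : S.terwilligerAlgebra ℂ x) : Matrix X X ℂ) =
        (matrixEquivTensor X ℚ ℂ).symm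
          ((S.terwilligerAlgebra ℚ x).val.toLinearMap.lTensor ℂ t) := by
      intro t
      induction t with
      | zero => simp
      | add s t hs ht => simp only [map_add, AddMemClass.coe_add, hs, ht]
      | tmul c a =>
        rw [extensionHom_tmul, LinearMap.lTensor_tmul, matrixEquivTensor_apply_symm]
        rfl
    have hinj : Function.Injective
        ((S.terwilligerAlgebra ℚ x).val.toLinearMap.lTensor ℂ) :=
      Module.Flat.lTensor_preserves_injective_linearMap _ Subtype.val_injective
    intro s t hst
    apply hinj
    apply (matrixEquivTensor X ℚ ℂ).symm.injective
    rw [← h, ← h, hst]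
  · have h : S.terwilligerAlgebra ℂ x ≤
        ((S.terwilligerAlgebra ℂ x).val.comp (S.extensionHom x)).range := by
      refine Algebra.adjoin_le ?_
      rintro _ (⟨i, rfl⟩ | ⟨i, rfl⟩)
      · refine ⟨1 ⊗ₜ ⟨_, S.adjMatrix_mem ℚ x i⟩, ?_⟩
        change ((S.extensionHom x _ : S.terwilligerAlgebra ℂ x) : Matrix X X ℂ) = _
        rw [extensionHom_tmul, one_smul]
        exact S.map_adjMatrix i
      · refine ⟨1 ⊗ₜ ⟨_, S.dualIdempotent_mem ℚ x i⟩, ?_⟩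
        change ((S.extensionHom x _ : S.terwilligerAlgebra ℂ x) : Matrix X X ℂ) = _
        rw [extensionHom_tmul, one_smul]
        exact S.map_dualIdempotent x i
    intro b
    obtain ⟨t, ht⟩ := h b.2
    exact ⟨t, Subtype.ext ht⟩

/-- The canonical isomorphism `ℂ ⊗ ℚT_x ≃ T_x`. -/
def extensionEquiv (x : X) :
    ℂ ⊗[ℚ] S.terwilligerAlgebra ℚ x ≃ₐ[ℂ] S.terwilligerAlgebra ℂ x :=
  AlgEquiv.ofBijective (S.extensionHom x) (S.extensionHom_bijective x)

section ComplexModule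

variable (x : X) (V : Type*) [AddCommGroup V] [Module ℂ V] [Module (S.terwilligerAlgebra ℂ x) V]
  [IsScalarTower ℂ (S.terwilligerAlgebra ℂ x) V]

/-- The subspace `E_i^* V`. -/
def dualSubspace (i : Fin (d + 1)) : Submodule ℂ V :=
  LinearMap.range (Algebra.lsmul ℂ ℂ V
    (⟨S.dualIdempotent ℂ x i, S.dualIdempotent_mem ℂ x i⟩ : S.terwilligerAlgebra ℂ x))

/-- `V` is thin: every `E_i^* V` has dimension at most `1`. -/
def IsThin : Prop := ∀ i, Module.rank ℂ (S.dualSubspace x V i) ≤ 1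

/-- The number of indices `i` with `E_i^* V ≠ 0`. -/
def dualDiameter : ℕ := {i | S.dualSubspace x V i ≠ ⊥}.ncard

/-- The character of `V`, `a ↦ tr (a | V)`. -/
def character : S.terwilligerAlgebra ℂ x →ₗ[ℂ] ℂ :=
  LinearMap.trace ℂ V ∘ₗ (Algebra.lsmul ℂ ℂ V).toLinearMap

end ComplexModule

/-- The field of character values `ℚ(χ)`: the subfield of `ℂ` generated by the `χ(a)`,
`a ∈ ℚT_x`. -/
def characterField (x : X) (χ : S.terwilligerAlgebra ℂ x →ₗ[ℂ] ℂ) : IntermediateField ℚ ℂ :=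
  IntermediateField.adjoin ℚ (Set.range fun a => χ (S.rationalInclusion x a))

/-- `e` is a centrally primitive idempotent of the ring `R`: a nonzero central idempotent which is
not the sum of two nonzero orthogonal central idempotents. -/
structure IsCentrallyPrimitive {R : Type*} [Ring R] (e : R) : Prop where
  idem : IsIdempotentElem e
  central : e ∈ Set.center R
  ne_zero : e ≠ 0
  eq_zero_or_eq_zero : ∀ f g : R, IsIdempotentElem f → f ∈ Set.center R →
    IsIdempotentElem g → g ∈ Set.center R → f * g = 0 → f + g = e → f = 0 ∨ g = 0

/-- `e` is the centrally primitive idempotent of `ℚT_x` determined by the `T_x`-module `V`, that is,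
the one which does not annihilate `V`. The simple component of `ℚT_x` determined by `V` is
`ℚT_x e = e ℚT_x e`, the ring `idem.Corner` with identity element `e`. -/
structure IsComponentIdempotent (x : X) (V : Type*) [AddCommGroup V]
    [Module (S.terwilligerAlgebra ℂ x) V] (e : S.terwilligerAlgebra ℚ x) : Prop
    extends IsCentrallyPrimitive e where
  exists_smul_ne_zero : ∃ v : V, S.rationalInclusion x e • v ≠ 0

/-- The `K`-algebra structure of the corner ring `e R e` of a `K`-algebra `R`. -/
instance cornerAlgebra {K R : Type*} [Field K] [Ring R] [Algebra K R] {e : R}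
    (he : IsIdempotentElem e) : Algebra K he.Corner where
  smul c a := ⟨c • a.1, by
    obtain ⟨r, hr⟩ := a.2
    exact ⟨c • r, by rw [← hr]; simp⟩⟩
  algebraMap :=
    { toFun := fun c => ⟨c • e, c • e, by simp [he.eq]⟩
      map_one' := Subtype.ext (one_smul K e)
      map_mul' := fun a b => Subtype.ext <| by
        change (a * b) • e = (a • e) * (b • e)
        rw [smul_mul_smul_comm, he.eq]
      map_zero' := Subtype.ext (zero_smul K e)
      map_add' := fun a b => Subtype.ext (add_smul a b e) }
  commutes' c a := Subtype.ext <| by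
    change (c • e) * a.1 = a.1 * (c • e)
    have h := (Subsemigroup.mem_corner_iff he).mp a.2
    rw [smul_mul_assoc, mul_smul_comm, h.1, h.2]
  smul_def' c a := Subtype.ext <| by
    change c • a.1 = (c • e) * a.1
    rw [smul_mul_assoc, ((Subsemigroup.mem_corner_iff he).mp a.2).1]

section RationalModule

variable (x : X) (W : Type*) [AddCommGroup W] [Module ℚ W] [Module (S.terwilligerAlgebra ℚ x) W]
  [IsScalarTower ℚ (S.terwilligerAlgebra ℚ x) W]

/-- The complex vector space `ℂ ⊗ W` for a `ℚT_x`-module `W`, as a `T_x`-module below. -/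
@[nolint unusedArguments]
def ComplexExtension (_S : AssociationScheme X d) (_x : X) (W : Type*) [AddCommGroup W]
    [Module ℚ W] : Type _ := ℂ ⊗[ℚ] W

instance : AddCommGroup (S.ComplexExtension x W) := inferInstanceAs (AddCommGroup (ℂ ⊗[ℚ] W))

instance : Module ℂ (S.ComplexExtension x W) := inferInstanceAs (Module ℂ (ℂ ⊗[ℚ] W))

/-- The representation of `T_x = ℂ ⊗ ℚT_x` on `ℂ ⊗ W`. -/
def extensionRep : S.terwilligerAlgebra ℂ x →ₐ[ℂ] Module.End ℂ (ℂ ⊗[ℚ] W) :=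
  (LinearMap.tensorProductEnd ℚ ℂ W).comp <|
    (Algebra.TensorProduct.map (AlgHom.id ℂ ℂ) (Algebra.lsmul ℚ ℚ W)).comp
      (S.extensionEquiv x).symm.toAlgHom

/-- `c a ∈ T_x`, with `c ∈ ℂ` and `a ∈ ℚT_x`, acts on `ℂ ⊗ W` by `z ⊗ w ↦ c z ⊗ a w`. -/
theorem extensionRep_apply (c z : ℂ) (a : S.terwilligerAlgebra ℚ x) (w : W) :
    S.extensionRep x W (c • S.rationalInclusion x a) (z ⊗ₜ w) = (c * z) ⊗ₜ (a • w) := by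
  have h : (S.extensionEquiv x).symm (c • S.rationalInclusion x a) = c ⊗ₜ a := by
    rw [AlgEquiv.symm_apply_eq]
    exact (S.extensionHom_tmul x c a).symm
  change LinearMap.tensorProductEnd ℚ ℂ W (Algebra.TensorProduct.map (AlgHom.id ℂ ℂ)
    (Algebra.lsmul ℚ ℚ W) ((S.extensionEquiv x).symm (c • S.rationalInclusion x a))) _ = _
  rw [h]
  change c • ((Algebra.lsmul ℚ ℚ W a).baseChange ℂ (z ⊗ₜ[ℚ] w)) = _
  rw [LinearMap.baseChange_tmul, TensorProduct.smul_tmul', smul_eq_mul]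
  rfl

instance : Module (S.terwilligerAlgebra ℂ x) (S.ComplexExtension x W) :=
  Module.compHom (ℂ ⊗[ℚ] W) (S.extensionRep x W).toRingHom

end RationalModule

/-- The multiplicity of the simple module `V` in the semisimple module `M`: the number of simple
summands in the sum of all submodules of `M` isomorphic to `V`. -/
def multiplicity (R V M : Type*) [Ring R] [AddCommGroup V] [Module R V] [AddCommGroup M]
    [Module R M] : ℕ∞ :=
  Module.length R (isotypicComponent R M V)

/-- `m` is the rational Schur index of the irreducible `T_x`-module `V` (or of its character):
if `e` is the centrally primitive idempotent of `ℚT_x` determined by `V` and `W` is the irreducible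
`ℚT_x`-module with `e W ≠ 0` (which exists and is unique up to isomorphism), then `V` has
multiplicity `m` in the `T_x`-module `ℂ ⊗ W`. -/
def HasRationalSchurIndex.{u₁, v₁, w₁} {X : Type u₁} [Fintype X] [DecidableEq X] {d : ℕ}
    (S : AssociationScheme X d) (x : X) (V : Type v₁) [AddCommGroup V]
    [Module (S.terwilligerAlgebra ℂ x) V] (m : ℕ∞) : Prop :=
  ∃ e : S.terwilligerAlgebra ℚ x, S.IsComponentIdempotent x V e ∧
    (∃ W : Submodule (S.terwilligerAlgebra ℚ x) (S.terwilligerAlgebra ℚ x),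
      IsSimpleModule (S.terwilligerAlgebra ℚ x) W ∧ ∃ w : W, e • w ≠ 0) ∧
    ∀ (W : Type w₁) [AddCommGroup W] [Module ℚ W] [Module (S.terwilligerAlgebra ℚ x) W]
      [IsScalarTower ℚ (S.terwilligerAlgebra ℚ x) W]
      [IsSimpleModule (S.terwilligerAlgebra ℚ x) W], (∃ w : W, e • w ≠ 0) →
      multiplicity (S.terwilligerAlgebra ℂ x) V (S.ComplexExtension x W) = m

end AssociationScheme

end

/-! Both Terwilliger algebras are closed under conjugate transposition, hence semisimple. So the
annihilator of `V` in `ℚT_x` is generated by a central idempotent `1 - e`, and the image of `ℚT_x`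
in `End V` is the corner at `e`. A central idempotent of `ℚT_x` acts on the simple module `V` as 0
or 1; this makes `e` centrally primitive and the only such idempotent not killing `V`.

Thinness enters twice. A nonzero vector from each nonzero `E_i^* V` gives a basis of `V` in which
the `E_i^*` with `E_i^* V ≠ 0` are the diagonal matrix units. The image `B` of `ℚT_x` then contains
these units, and simplicity of `V` makes every entry nonzero somewhere on `B`. Conjugation by a
diagonal matrix carries such a `B` onto the full matrix algebra over the field generated by its
traces, which is `ℚ(χ)` (`Subalgebra.exists_diagonal_conj`).

For the Schur index, take `w ≠ 0` in some `E_i^* W`. Then `1 ⊗ w` generates `ℂ ⊗ W`, and every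
homomorphism to `V` sends it into `E_i^* V`, of dimension at most 1, so all homomorphisms are
proportional (`IsThin.ker_le_ker`). A nonzero one exists because `W` is a minimal left ideal not
annihilating `V`. -/

section Semisimple

/-! ### Semisimplicity of self-adjoint matrix algebras, and their ideals. -/

theorem Matrix.IsHermitian.eq_zero_of_isNilpotent {K n : Type*} [Field K] [PartialOrder K]
    [StarRing K] [StarOrderedRing K] [Fintype n] [DecidableEq n] {a : Matrix n n K}
    (ha : a.IsHermitian) (hn : IsNilpotent a) : a = 0 := by
  obtain ⟨m, hm⟩ := hn
  -- The square of a Hermitian `b` is `bᴴ * b`, which vanishes only if `b` does; this halves an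
  -- exponent `2 ^ k`.
  have key : ∀ k : ℕ, a ^ 2 ^ k = 0 → a = 0 := by
    intro k
    induction k with
    | zero => simp
    | succ k ih =>
      intro h
      refine ih (Matrix.conjTranspose_mul_self_eq_zero.mp ?_)
      rw [(ha.pow _).eq, ← pow_two, ← pow_mul, ← pow_succ, h]
  exact key m (pow_eq_zero_of_le Nat.lt_two_pow_self.le hm)

/-- The Jacobson radical is nilpotent. If it contains `a`, it contains the Hermitian matrix `aᴴ *
a`, which is then nilpotent, so zero. -/
theorem Subalgebra.isSemisimpleRing_of_conjTranspose_mem {K n : Type*} [Field K] [PartialOrder K]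
    [StarRing K] [StarOrderedRing K] [Fintype n] [DecidableEq n]
    (A : Subalgebra K (Matrix n n K)) (hA : ∀ a ∈ A, a.conjTranspose ∈ A) :
    IsSemisimpleRing A := by
  have : IsArtinianRing A := IsArtinianRing.of_finite K A
  rw [IsArtinianRing.isSemisimpleRing_iff_jacobson, eq_bot_iff]
  intro a ha
  obtain ⟨m, hm⟩ := IsSemiprimaryRing.isNilpotent (R := A)
  have hmem : (⟨_, hA a a.2⟩ * a : A) ∈ Ring.jacobson A := Ideal.mul_mem_left _ _ ha
  have hpow := Ideal.pow_mem_pow hmem m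
  rw [hm] at hpow
  have h0 : a.1.conjTranspose * a.1 = 0 :=
    (Matrix.isHermitian_conjTranspose_mul_self a.1).eq_zero_of_isNilpotent
      ⟨m, congrArg Subtype.val ((Submodule.mem_bot A).mp hpow)⟩
  exact Subtype.ext (Matrix.conjTranspose_mul_self_eq_zero.mp h0)

/-- Semiprimeness: the left ideal of `x` has an idempotent generator `e = b * x`, and `e = e * e = b
* (x * b * x) = 0`. -/
theorem IsSemisimpleRing.eq_zero_of_mul_mul_eq_zero {A : Type*} [Ring A] [IsSemisimpleRing A]
    {x : A} (hx : ∀ b, x * b * x = 0) : x = 0 := by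
  obtain ⟨e, he, hspan⟩ := IsSemisimpleRing.ideal_eq_span_idempotent (Ideal.span {x})
  obtain ⟨b, hb⟩ := Ideal.mem_span_singleton'.mp (hspan ▸ Ideal.mem_span_singleton_self e)
  obtain ⟨c, hc⟩ := Ideal.mem_span_singleton'.mp (hspan ▸ Ideal.mem_span_singleton_self x)
  have h0 : e = 0 := by
    rw [← he.eq, ← hb, ← mul_assoc, mul_assoc b, mul_assoc b, hx, mul_zero]
  rw [← hc, h0, mul_zero]

/-- The kernel of a homomorphism from a semisimple ring is the annihilator of a central
idempotent. -/
theorem IsSemisimpleRing.exists_central_idempotent_ker {A B : Type*} [Ring A] [IsSemisimpleRing A]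
    [Ring B] (φ : A →+* B) :
    ∃ e : A, IsIdempotentElem e ∧ e ∈ Set.center A ∧ φ e = 1 ∧ ∀ a, φ a = 0 → a * e = 0 := by
  obtain ⟨f, hf, hspan⟩ := IsSemisimpleRing.ideal_eq_span_idempotent (RingHom.ker φ)
  have hφf : φ f = 0 := RingHom.mem_ker.mp (hspan ▸ Ideal.mem_span_singleton_self f)
  have hker : ∀ a, φ a = 0 → a * f = a := by
    intro a ha
    obtain ⟨c, rfl⟩ := Ideal.mem_span_singleton'.mp (hspan ▸ RingHom.mem_ker.mpr ha)
    rw [mul_assoc, hf.eq]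
  have h₁ : ∀ a, f * a * f = f * a := fun a => hker _ (by rw [map_mul, hφf, zero_mul])
  -- With `h₁`, which says `f * b * (1 - f) = 0`, the element `y = (1 - f) * a * f` satisfies `y * b
  -- * y = 0`. Its vanishing gives `a * f = f * a * f = f * a`.
  have h₂ : ∀ a, (1 - f) * (a * f) = 0 := by
    intro a
    refine IsSemisimpleRing.eq_zero_of_mul_mul_eq_zero fun b => ?_
    have : f * b * ((1 - f) * (a * f)) = 0 := by
      rw [← mul_assoc, mul_sub, mul_one, h₁, sub_self, zero_mul]
    rw [mul_assoc, mul_assoc (1 - f), mul_assoc a, ← mul_assoc f, this, mul_zero, mul_zero]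
  refine ⟨1 - f, hf.one_sub, ?_, by simp [hφf], fun a ha => by rw [mul_sub, mul_one, hker a ha,
    sub_self]⟩
  rw [Semigroup.mem_center_iff]
  intro a
  have h₃ := h₂ a
  rw [sub_mul, one_mul, sub_eq_zero, ← mul_assoc, h₁] at h₃
  rw [mul_sub, sub_mul, one_mul, mul_one, h₃]

end Semisimple

/-! ### Matrix algebras over an extension field that descend to the trace field. -/

section MatrixDescent

open Matrix

variable {k F J : Type*} [Field k] [Field F] [Algebra k F] [Fintype J] [DecidableEq J]

/-- The field generated by the traces of the elements of a matrix algebra. -/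
noncomputable def Subalgebra.traceField (B : Subalgebra k (Matrix J J F)) : IntermediateField k F :=
  IntermediateField.adjoin k (Set.range fun b : B => b.1.trace)

theorem Subalgebra.single_apply_mem {B : Subalgebra k (Matrix J J F)}
    (hs : ∀ j, single j j (1 : F) ∈ B) {b : Matrix J J F} (hb : b ∈ B) (j l : J) :
    single j l (b j l) ∈ B := by
  have h := B.mul_mem (B.mul_mem (hs j) hb) (hs l)
  convert h using 1
  rw [Matrix.single_mul_mul_single]
  simp

theorem Subalgebra.exists_diagonal_conj (B : Subalgebra k (Matrix J J F)) [Module.Finite k B]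
    (hs : ∀ j, single j j (1 : F) ∈ B) (hB : ∀ j l, ∃ b ∈ B, b j l ≠ 0) :
    ∃ g : J → F, (∀ j, g j ≠ 0) ∧
      ∀ b, b ∈ B ↔ ∀ j l, g j * b j l * (g l)⁻¹ ∈ B.traceField := by
  cases isEmpty_or_nonempty J with
  | inl h =>
    refine ⟨fun _ => 1, fun _ => one_ne_zero, fun b => ⟨fun _ j => (h.false j).elim, fun _ => ?_⟩⟩
    rw [Subsingleton.elim b 0]
    exact B.zero_mem
  | inr h =>
  obtain ⟨o⟩ := h
  have hmul : ∀ {i j l c c'}, single i j c ∈ B → single j l c' ∈ B → single i l (c * c') ∈ B := by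
    intro i j l c c' h h'
    simpa using B.mul_mem h h'
  -- The corner of `B` at `o`, read as a set of scalars. It embeds in `B`, so it is
  -- finite-dimensional over `k` and therefore a field.
  let L₀ : Subalgebra k F :=
    { carrier := {c | single o o c ∈ B}
      mul_mem' := hmul
      add_mem' := fun {c c'} h h' => by
        simpa [Matrix.single_add] using B.add_mem h h'
      algebraMap_mem' := fun r => by
        have := B.smul_mem (hs o) r
        rwa [Matrix.smul_single, Algebra.smul_def, mul_one] at this }
  have hL₀ : ∀ c, c ∈ L₀ ↔ single o o c ∈ B := fun _ => Iff.rfl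
  let ι : L₀ →ₗ[k] B :=
    { toFun := fun c => ⟨single o o c.1, c.2⟩
      map_add' := fun c c' => Subtype.ext (Matrix.single_add o o c.1 c'.1)
      map_smul' := fun r c => Subtype.ext (Matrix.smul_single r o o c.1).symm }
  have hι : Function.Injective ι := fun c c' h => by
    have := congrFun (congrFun (congrArg Subtype.val h) o) o
    simpa [ι] using this
  have : Module.Finite k L₀ := Module.Finite.of_injective ι hι
  have hinv : ∀ c ∈ L₀, c⁻¹ ∈ L₀ := fun c hc =>
    L₀.inv_mem_of_algebraic (x := ⟨c, hc⟩)
      ((Algebra.IsAlgebraic.isAlgebraic (R := k) (⟨c, hc⟩ : L₀)).algebraMap (A := F))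
  have hex : ∀ j l, ∃ c, c ≠ 0 ∧ single j l c ∈ B := fun j l => by
    obtain ⟨b, hb, h0⟩ := hB j l
    exact ⟨_, h0, single_apply_mem hs hb j l⟩
  choose g hg0 hg using fun j => hex o j
  choose h hh0 hh using fun j => hex j o
  have hgh : ∀ j, (g j * h j)⁻¹ ∈ L₀ := fun j => hinv _ (hmul (hg j) (hh j))
  -- Multiplying by the units `g` and `h` moves position `(j, l)` to `(o, o)` and back; the factors
  -- `(g j * h j)⁻¹ ∈ L₀` correct the scalars.
  have hiff : ∀ j l c, single j l c ∈ B ↔ g j * c * (g l)⁻¹ ∈ L₀ := by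
    intro j l c
    constructor
    · intro hc
      have h1 : g j * c * h l * (g l * h l)⁻¹ ∈ L₀ :=
        L₀.mul_mem (hmul (hmul (hg j) hc) (hh l)) (hgh l)
      convert h1 using 1
      have := hg0 l
      have := hh0 l
      field_simp
    · intro hc
      have h1 := hmul (hmul (hh j) ((hL₀ _).mp (L₀.mul_mem (hgh j) hc))) (hg l)
      convert h1 using 2
      have := hg0 l
      have := hg0 j
      have := hh0 j
      field_simp
  have hmem : ∀ b, b ∈ B ↔ ∀ j l, g j * b j l * (g l)⁻¹ ∈ L₀ := by
    intro b
    refine ⟨fun hb j l => (hiff j l _).mp (single_apply_mem hs hb j l), fun hb => ?_⟩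
    rw [Matrix.matrix_eq_sum_single b]
    exact B.sum_mem fun j _ => B.sum_mem fun l _ => (hiff j l _).mpr (hb j l)
  -- Diagonal entries are unchanged by diagonal conjugation, so traces lie in `L₀`; conversely `c`
  -- is the trace of `single o o c`.
  have hK : ∀ c, c ∈ B.traceField ↔ c ∈ L₀ := by
    intro c
    constructor
    · suffices hle : B.traceField ≤ L₀.toIntermediateField hinv from fun hc => hle hc
      refine IntermediateField.adjoin_le_iff.mpr ?_
      rintro _ ⟨b, rfl⟩
      refine L₀.sum_mem fun j _ => ?_
      have := (hmem b.1).mp b.2 j j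
      rwa [mul_comm (g j), mul_inv_cancel_right₀ (hg0 j)] at this
    · intro hc
      refine IntermediateField.subset_adjoin k _ ⟨⟨single o o c, hc⟩, ?_⟩
      simp
  exact ⟨g, hg0, fun b => by simp only [hmem, hK]⟩

/-- A finite-dimensional matrix algebra which contains the diagonal matrix units and in which no
entry vanishes identically is a full matrix algebra over its trace field. -/
theorem Subalgebra.nonempty_algEquiv_matrix_traceField (B : Subalgebra k (Matrix J J F))
    [Module.Finite k B] (hs : ∀ j, single j j (1 : F) ∈ B) (hB : ∀ j l, ∃ b ∈ B, b j l ≠ 0) :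
    Nonempty (B ≃ₐ[k] Matrix J J B.traceField) := by
  obtain ⟨g, hg0, hg⟩ := B.exists_diagonal_conj hs hB
  let ψ : B →ₐ[k] Matrix J J B.traceField :=
    { toFun := fun b => Matrix.of fun j l => ⟨g j * b.1 j l * (g l)⁻¹, (hg b.1).mp b.2 j l⟩
      map_one' := by
        ext j l
        rcases eq_or_ne j l with rfl | h
        · simp [hg0]
        · simp [h]
      map_mul' := fun a b => by
        ext j l
        simp only [MulMemClass.coe_mul, Matrix.mul_apply, Matrix.of_apply,
          AddSubmonoidClass.coe_finsetSum, Finset.mul_sum, Finset.sum_mul]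
        refine Finset.sum_congr rfl fun m _ => ?_
        have := hg0 m
        field_simp
      map_zero' := by ext; simp
      map_add' := fun a b => by ext; simp [mul_add, add_mul]
      commutes' := fun r => by
        ext j l
        rcases eq_or_ne j l with rfl | h
        · simp [Matrix.algebraMap_matrix_apply, mul_comm (g _), hg0]
        · simp [Matrix.algebraMap_matrix_apply, h] }
  refine ⟨AlgEquiv.ofBijective ψ ⟨fun a b hab => ?_, fun m => ?_⟩⟩
  · ext j l
    have := congrArg Subtype.val (congrFun (congrFun hab j) l)
    simpa [ψ, hg0] using this
  · refine ⟨⟨Matrix.of fun j l => (g j)⁻¹ * (m j l).1 * g l, (hg _).mpr fun j l => ?_⟩, ?_⟩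
    · convert (m j l).2 using 1
      have := hg0 l
      have := hg0 j
      simp only [Matrix.of_apply]
      field_simp
    · ext j l
      have := hg0 l
      have := hg0 j
      simp only [ψ, AlgHom.coe_mk, RingHom.coe_mk, MonoidHom.coe_mk, OneHom.coe_mk, Matrix.of_apply]
      field_simp

end MatrixDescent

/-! ### Terwilliger algebras: semisimplicity, dual idempotents, rational span. -/

namespace AssociationScheme

variable {X : Type*} [Fintype X] [DecidableEq X] {d : ℕ} (S : AssociationScheme X d)

theorem conjTranspose_mem_terwilligerAlgebra (K : Type*) [Field K] [StarRing K] (x : X)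
    {a : Matrix X X K} (ha : a ∈ S.terwilligerAlgebra K x) :
    a.conjTranspose ∈ S.terwilligerAlgebra K x := by
  induction ha using Algebra.adjoin_induction with
  | mem a ha =>
    rcases ha with ⟨i, rfl⟩ | ⟨i, rfl⟩
    · obtain ⟨j, hj⟩ := S.exists_transpose i
      have : (S.adjMatrix K i).conjTranspose = S.adjMatrix K j := by
        ext u v
        by_cases h : S.rel u v = j
        · simp [adjMatrix, (hj v u).mpr h, h]
        · simp [adjMatrix, mt (hj v u).mp h, h]
      exact this ▸ S.adjMatrix_mem K x j
    · have : (S.dualIdempotent K x i).conjTranspose = S.dualIdempotent K x i := by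
        rw [dualIdempotent, Matrix.diagonal_conjTranspose]
        congr 1
        ext u
        by_cases h : S.rel x u = i <;> simp [adjMatrix, h]
      exact this.symm ▸ S.dualIdempotent_mem K x i
  | algebraMap r =>
    rw [Matrix.algebraMap_eq_diagonal, Matrix.diagonal_conjTranspose]
    exact (S.terwilligerAlgebra K x).algebraMap_mem (star r)
  | add a b _ _ ha hb => rw [Matrix.conjTranspose_add]; exact Subalgebra.add_mem _ ha hb
  | mul a b _ _ ha hb => rw [Matrix.conjTranspose_mul]; exact Subalgebra.mul_mem _ hb ha

instance isSemisimpleRing_rat (x : X) : IsSemisimpleRing (S.terwilligerAlgebra ℚ x) :=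
  Subalgebra.isSemisimpleRing_of_conjTranspose_mem _ fun _ =>
    S.conjTranspose_mem_terwilligerAlgebra ℚ x

open scoped ComplexOrder in
instance isSemisimpleRing_complex (x : X) : IsSemisimpleRing (S.terwilligerAlgebra ℂ x) :=
  Subalgebra.isSemisimpleRing_of_conjTranspose_mem _ fun _ =>
    S.conjTranspose_mem_terwilligerAlgebra ℂ x

/-- The dual idempotent as an element of the Terwilliger algebra. -/
def dualElement (K : Type*) [Field K] (x : X) (i : Fin (d + 1)) : S.terwilligerAlgebra K x :=
  ⟨S.dualIdempotent K x i, S.dualIdempotent_mem K x i⟩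

theorem completeOrthogonalIdempotents_dualElement (K : Type*) [Field K] (x : X) :
    CompleteOrthogonalIdempotents (S.dualElement K x) where
  idem i := Subtype.ext <| by
    simp only [dualElement, MulMemClass.coe_mul, dualIdempotent, Matrix.diagonal_mul_diagonal]
    congr 1
    ext u
    simp [adjMatrix]
  ortho i j hij := Subtype.ext <| by
    simp only [dualElement, MulMemClass.coe_mul, dualIdempotent, Matrix.diagonal_mul_diagonal]
    rw [ZeroMemClass.coe_zero, ← Matrix.diagonal_zero]
    congr 1
    ext u
    simp only [adjMatrix, Matrix.of_apply, mul_ite, mul_one, mul_zero]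
    split_ifs with h h' <;> simp_all
  complete := Subtype.ext <| by
    rw [AddSubmonoidClass.coe_finsetSum]
    ext u v
    rw [Matrix.sum_apply]
    rcases eq_or_ne u v with rfl | h
    · simp [dualElement, dualIdempotent, adjMatrix]
    · simp [dualElement, dualIdempotent, h]

theorem rationalInclusion_dualElement (x : X) (i : Fin (d + 1)) :
    S.rationalInclusion x (S.dualElement ℚ x i) = S.dualElement ℂ x i :=
  Subtype.ext (S.map_dualIdempotent x i)

theorem span_range_rationalInclusion (x : X) :
    Submodule.span ℂ (Set.range (S.rationalInclusion x)) = ⊤ := by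
  rw [eq_top_iff]
  intro b _
  obtain ⟨t, rfl⟩ := (S.extensionHom_bijective x).2 b
  induction t with
  | zero => simp
  | add s t hs ht => rw [map_add]; exact add_mem (hs trivial) (ht trivial)
  | tmul c a =>
    rw [extensionHom_tmul]
    exact Submodule.smul_mem _ _ (Submodule.subset_span ⟨a, rfl⟩)

/-! ### Matrices of `ℚT_x` on a thin module. -/

section ThinModule

variable (x : X) (V : Type*) [AddCommGroup V] [Module ℂ V] [Module (S.terwilligerAlgebra ℂ x) V]
  [IsScalarTower ℂ (S.terwilligerAlgebra ℂ x) V]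

omit [Module ℂ V] [IsScalarTower ℂ (S.terwilligerAlgebra ℂ x) V] in
theorem sum_dualElement_smul (v : V) : ∑ i, S.dualElement ℂ x i • v = v := by
  rw [← Finset.sum_smul, (S.completeOrthogonalIdempotents_dualElement ℂ x).complete, one_smul]

theorem mem_dualSubspace_iff (i : Fin (d + 1)) (v : V) :
    v ∈ S.dualSubspace x V i ↔ S.dualElement ℂ x i • v = v := by
  constructor
  · rintro ⟨w, rfl⟩
    change S.dualElement ℂ x i • S.dualElement ℂ x i • w = S.dualElement ℂ x i • w
    rw [← mul_smul, ((S.completeOrthogonalIdempotents_dualElement ℂ x).idem i).eq]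
  · exact fun h => ⟨v, h⟩

theorem dualElement_smul_mem (i : Fin (d + 1)) (v : V) :
    S.dualElement ℂ x i • v ∈ S.dualSubspace x V i :=
  ⟨v, rfl⟩

variable {V}

theorem IsThin.exists_smul_eq (hV : S.IsThin x V) {i : Fin (d + 1)} {v w : V}
    (hv : v ∈ S.dualSubspace x V i) (hv0 : v ≠ 0) (hw : w ∈ S.dualSubspace x V i) :
    ∃ c : ℂ, c • v = w := by
  obtain ⟨u, hu⟩ := (rank_submodule_le_one_iff' _).mp (hV i)
  obtain ⟨a, rfl⟩ := Submodule.mem_span_singleton.mp (hu hv)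
  obtain ⟨b, rfl⟩ := Submodule.mem_span_singleton.mp (hu hw)
  have ha : a ≠ 0 := fun h => hv0 (by rw [h, zero_smul])
  exact ⟨b * a⁻¹, by rw [smul_smul, inv_mul_cancel_right₀ ha]⟩

/-- The indices in the dual support of `V`. -/
abbrev dualSupport (V : Type*) [AddCommGroup V] [Module ℂ V]
    [Module (S.terwilligerAlgebra ℂ x) V] [IsScalarTower ℂ (S.terwilligerAlgebra ℂ x) V] :
    Set (Fin (d + 1)) :=
  {i | S.dualSubspace x V i ≠ ⊥}

/-- A thin module has a basis of common eigenvectors for the dual idempotents. -/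
theorem IsThin.exists_basis (hV : S.IsThin x V) :
    ∃ b : Module.Basis (S.dualSupport x V) ℂ V,
      ∀ i j, S.dualElement ℂ x i • b j = if i = j then b j else 0 := by
  have hE := S.completeOrthogonalIdempotents_dualElement ℂ x
  have hex : ∀ j : S.dualSupport x V, ∃ v ∈ S.dualSubspace x V j, v ≠ 0 := fun j =>
    (Submodule.ne_bot_iff _).mp j.2
  choose u hu hu0 using hex
  have hact : ∀ (i : Fin (d + 1)) (j : S.dualSupport x V),
      S.dualElement ℂ x i • u j = if i = j then u j else 0 := by
    intro i j
    have hj := (S.mem_dualSubspace_iff x V j (u j)).mp (hu j)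
    split_ifs with h
    · rw [h, hj]
    · rw [← hj, ← mul_smul, hE.ortho h, zero_smul]
  have hli : LinearIndependent ℂ u := by
    rw [Fintype.linearIndependent_iff]
    intro g hg j
    -- Applying the dual idempotent of index `j` isolates the coefficient of `u j`.
    have h := congrArg (S.dualElement ℂ x j • ·) hg
    simp only [Finset.smul_sum, smul_zero, smul_comm (S.dualElement ℂ x j), hact] at h
    rw [Finset.sum_eq_single j] at h
    · simpa [hu0 j] using h
    · intro l _ hl
      rw [if_neg fun h => hl (Subtype.ext h.symm), smul_zero]
    · simp
  have hspan : ⊤ ≤ Submodule.span ℂ (Set.range u) := by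
    intro v _
    rw [← S.sum_dualElement_smul x V v]
    refine Submodule.sum_mem _ fun i _ => ?_
    have hi := S.dualElement_smul_mem x V i v
    by_cases h : S.dualSubspace x V i = ⊥
    · rw [h, Submodule.mem_bot] at hi
      rw [hi]
      exact Submodule.zero_mem _
    · obtain ⟨c, hc⟩ := IsThin.exists_smul_eq S x hV (hu ⟨i, h⟩) (hu0 ⟨i, h⟩) hi
      rw [← hc]
      exact Submodule.smul_mem _ _ (Submodule.subset_span ⟨_, rfl⟩)
  exact ⟨Module.Basis.mk hli hspan, fun i j => by simpa using hact i j⟩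

/-- An entry vanishing on `ℚT_x` would vanish on its complex span `T_x`, but `b l` generates the
simple module `V` and so reaches `b j`. -/
theorem exists_repr_smul_ne_zero [IsSimpleModule (S.terwilligerAlgebra ℂ x) V] {J : Type*}
    (b : Module.Basis J ℂ V) (j l : J) :
    ∃ a, b.repr (S.rationalInclusion x a • b l) j ≠ 0 := by
  by_contra! h
  have hle : ∀ t : S.terwilligerAlgebra ℂ x, b.repr (t • b l) j = 0 := by
    intro t
    have ht : t ∈ Submodule.span ℂ (Set.range (S.rationalInclusion x)) :=
      S.span_range_rationalInclusion x ▸ Submodule.mem_top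
    induction ht using Submodule.span_induction with
    | mem t ht => obtain ⟨a, rfl⟩ := ht; exact h a
    | zero => simp
    | add s t _ _ hs ht => simp [add_smul, hs, ht]
    | smul c t _ ht => simp [ht]
  obtain ⟨t, ht⟩ := IsSimpleModule.toSpanSingleton_surjective (S.terwilligerAlgebra ℂ x)
    (b.ne_zero l) (b j)
  have := hle t
  rw [← LinearMap.toSpanSingleton_apply, ht] at this
  simp at this

/-- The rational Terwilliger algebra acting by complex matrices with respect to a basis of `V`. -/
noncomputable def matrixRep {J : Type*} [Fintype J] [DecidableEq J] (b : Module.Basis J ℂ V) :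
    S.terwilligerAlgebra ℚ x →ₐ[ℚ] Matrix J J ℂ :=
  (((LinearMap.toMatrixAlgEquiv b).toAlgHom.comp
    (Algebra.lsmul ℂ ℂ V : S.terwilligerAlgebra ℂ x →ₐ[ℂ] _)).restrictScalars ℚ).comp
      (S.rationalInclusion x)

variable {J : Type*} [Fintype J] [DecidableEq J] (b : Module.Basis J ℂ V)

theorem matrixRep_apply (a : S.terwilligerAlgebra ℚ x) (j l : J) :
    S.matrixRep x b a j l = b.repr (S.rationalInclusion x a • b l) j :=
  LinearMap.toMatrixAlgEquiv_apply b _ j l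

theorem trace_matrixRep (a : S.terwilligerAlgebra ℚ x) :
    (S.matrixRep x b a).trace = S.character x V (S.rationalInclusion x a) :=
  (LinearMap.trace_eq_matrix_trace ℂ b _).symm

theorem traceField_range_matrixRep :
    (S.matrixRep x b).range.traceField = S.characterField x (S.character x V) := by
  rw [Subalgebra.traceField, characterField]
  congr 1
  ext c
  constructor
  · rintro ⟨⟨_, a, rfl⟩, rfl⟩
    exact ⟨a, (S.trace_matrixRep x b a).symm⟩
  · rintro ⟨a, rfl⟩
    exact ⟨⟨_, a, rfl⟩, S.trace_matrixRep x b a⟩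

theorem matrixRep_eq_iff (a a' : S.terwilligerAlgebra ℚ x) :
    S.matrixRep x b a = S.matrixRep x b a' ↔
      ∀ v : V, S.rationalInclusion x a • v = S.rationalInclusion x a' • v := by
  refine ((LinearMap.toMatrixAlgEquiv b).injective.eq_iff (a := Algebra.lsmul ℂ ℂ V _)
    (b := Algebra.lsmul ℂ ℂ V _)).trans LinearMap.ext_iff

end ThinModule

end AssociationScheme

/-! ### Corners, central idempotents and multiplicity one in general rings. -/

section Generic

theorem IsIdempotentElem.nonempty_corner_algEquiv_range {K A B : Type*} [Field K] [Ring A]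
    [Algebra K A] [Ring B] [Algebra K B] (φ : A →ₐ[K] B) {e : A} (he : IsIdempotentElem e)
    (h1 : φ e = 1) (hker : ∀ a, φ a = 0 → a * e = 0) :
    Nonempty (he.Corner ≃ₐ[K] φ.range) := by
  let ψ : he.Corner →ₐ[K] φ.range :=
    { toFun := fun a => ⟨φ a.1, a.1, rfl⟩
      map_one' := Subtype.ext h1
      map_mul' := fun a b => Subtype.ext (map_mul φ a.1 b.1)
      map_zero' := Subtype.ext (map_zero φ)
      map_add' := fun a b => Subtype.ext (map_add φ a.1 b.1)
      commutes' := fun r => Subtype.ext <| by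
        change φ (r • e) = algebraMap K B r
        rw [map_smul, h1, Algebra.algebraMap_eq_smul_one] }
  refine ⟨AlgEquiv.ofBijective ψ ⟨?_, ?_⟩⟩
  · rw [injective_iff_map_eq_zero]
    intro a ha
    have h := hker a.1 (congrArg Subtype.val ha)
    rw [((Subsemigroup.mem_corner_iff he).mp a.2).2] at h
    exact Subtype.ext h
  · rintro ⟨_, a, rfl⟩
    refine ⟨⟨e * a * e, a, rfl⟩, Subtype.ext ?_⟩
    change φ (e * a * e) = φ a
    rw [map_mul, map_mul, h1, one_mul, mul_one]

theorem IsSimpleModule.smul_eq_zero_or_eq_self {R M : Type*} [Ring R] [AddCommGroup M] [Module R M]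
    [IsSimpleModule R M] {f : R} (hf : IsIdempotentElem f) (hc : f ∈ Set.center R) :
    (∀ m : M, f • m = 0) ∨ ∀ m : M, f • m = m := by
  have hcomm := Semigroup.mem_center_iff.mp hc
  let N : Submodule R M :=
    { carrier := {m | f • m = 0}
      add_mem' := fun {a b} ha hb => by
        change f • (a + b) = 0
        rw [smul_add, ha, hb, add_zero]
      zero_mem' := smul_zero f
      smul_mem' := fun r m hm => by
        change f • r • m = 0
        rw [← mul_smul, ← hcomm, mul_smul, hm, smul_zero] }
  rcases eq_bot_or_eq_top N with h | h
  · right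
    intro m
    have : f • m - m ∈ N := by
      change f • (f • m - m) = 0
      rw [smul_sub, ← mul_smul, hf.eq, sub_self]
    rw [h, Submodule.mem_bot, sub_eq_zero] at this
    exact this
  · exact Or.inl fun m => (h ▸ Submodule.mem_top : m ∈ N)

/-- If there is a nonzero homomorphism from a semisimple module `M` to the simple module `V`, and
its kernel is contained in the kernel of every other one, then `V` occurs exactly once in `M`. -/
theorem length_isotypicComponent_eq_one {R M V : Type*} [Ring R] [AddCommGroup M] [Module R M]
    [AddCommGroup V] [Module R V] [IsSemisimpleModule R M] [IsSimpleModule R V] (f : M →ₗ[R] V)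
    (hf : f ≠ 0) (hker : ∀ g : M →ₗ[R] V, LinearMap.ker f ≤ LinearMap.ker g) :
    Module.length R (isotypicComponent R M V) = 1 := by
  obtain ⟨C, hC⟩ := exists_isCompl (LinearMap.ker f)
  let eC : C ≃ₗ[R] V := (Submodule.quotientEquivOfIsCompl _ C hC).symm.trans
    (f.quotKerEquivOfSurjective (LinearMap.surjective_of_ne_zero hf))
  have : IsSimpleModule R C := IsSimpleModule.congr eC
  have huniq : ∀ P : Submodule R M, Nonempty (P ≃ₗ[R] V) → P = C := by
    rintro P ⟨eP⟩
    have : IsSimpleModule R P := IsSimpleModule.congr eP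
    have hPatom := isSimpleModule_iff_isAtom.mp this
    have hCatom := isSimpleModule_iff_isAtom.mp ‹IsSimpleModule R C›
    by_contra hne
    obtain ⟨U, hCU, hU⟩ := (hPatom.disjoint_of_ne hCatom hne).symm.exists_isCompl
    have h := hker (eP.toLinearMap.comp (P.projectionOnto U hU.symm))
    rw [LinearEquiv.ker_comp, Submodule.ker_projectionOnto] at h
    have htop : U = ⊤ := by
      rw [eq_top_iff, ← hC.sup_eq_top]
      exact sup_le h hCU
    have hbot := hU.inf_eq_bot
    rw [htop, top_inf_eq] at hbot
    exact hPatom.1 hbot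
  have hcomp : isotypicComponent R M V = C :=
    le_antisymm (sSup_le fun P hP => (huniq P hP).le) (le_sSup ⟨eC⟩)
  rw [hcomp]
  exact Module.length_eq_one R C

end Generic

namespace AssociationScheme

variable {X : Type*} [Fintype X] [DecidableEq X] {d : ℕ} (S : AssociationScheme X d)

theorem rationalInclusion_mem_center (x : X) {f : S.terwilligerAlgebra ℚ x}
    (hf : f ∈ Set.center (S.terwilligerAlgebra ℚ x)) :
    S.rationalInclusion x f ∈ Set.center (S.terwilligerAlgebra ℂ x) := by
  rw [Semigroup.mem_center_iff] at hf ⊢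
  intro t
  have ht : t ∈ Submodule.span ℂ (Set.range (S.rationalInclusion x)) :=
    S.span_range_rationalInclusion x ▸ Submodule.mem_top
  induction ht using Submodule.span_induction with
  | mem t ht => obtain ⟨a, rfl⟩ := ht; rw [← map_mul, hf, map_mul]
  | zero => simp
  | add s t _ _ hs ht => rw [add_mul, mul_add, hs, ht]
  | smul c t _ ht => rw [smul_mul_assoc, mul_smul_comm, ht]

section Component

variable (x : X) (V : Type*) [AddCommGroup V] [Module (S.terwilligerAlgebra ℂ x) V]

/-- `e` is a central idempotent of `ℚT_x` which generates a complement of the annihilator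
of `V`. -/
structure IsAnnihilatorComplement (e : S.terwilligerAlgebra ℚ x) : Prop where
  idem : IsIdempotentElem e
  central : e ∈ Set.center (S.terwilligerAlgebra ℚ x)
  smul_eq : ∀ v : V, S.rationalInclusion x e • v = v
  mul_eq_zero : ∀ a, (∀ v : V, S.rationalInclusion x a • v = 0) → a * e = 0

theorem exists_isAnnihilatorComplement : ∃ e, S.IsAnnihilatorComplement x V e := by
  let φ : S.terwilligerAlgebra ℚ x →+* Module.End ℤ V :=
    (Module.toModuleEnd ℤ (S := S.terwilligerAlgebra ℂ x) V).comp
      (S.rationalInclusion x).toRingHom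
  obtain ⟨e, he, hc, h1, h0⟩ := IsSemisimpleRing.exists_central_idempotent_ker φ
  exact ⟨e, he, hc, fun v => LinearMap.congr_fun h1 v, fun a ha => h0 a (LinearMap.ext ha)⟩

variable {S x V} [IsSimpleModule (S.terwilligerAlgebra ℂ x) V] {e : S.terwilligerAlgebra ℚ x}

theorem rationalInclusion_smul_eq_zero_or_eq_self {f : S.terwilligerAlgebra ℚ x}
    (hf : IsIdempotentElem f) (hc : f ∈ Set.center (S.terwilligerAlgebra ℚ x)) :
    (∀ v : V, S.rationalInclusion x f • v = 0) ∨ ∀ v : V, S.rationalInclusion x f • v = v :=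
  IsSimpleModule.smul_eq_zero_or_eq_self (hf.map (S.rationalInclusion x))
    (S.rationalInclusion_mem_center x hc)

theorem IsAnnihilatorComplement.isComponentIdempotent (h : S.IsAnnihilatorComplement x V e) :
    S.IsComponentIdempotent x V e where
  idem := h.idem
  central := h.central
  ne_zero := by
    rintro rfl
    have := IsSimpleModule.nontrivial (S.terwilligerAlgebra ℂ x) V
    obtain ⟨v, hv⟩ := exists_ne (0 : V)
    exact hv (by rw [← h.smul_eq v, map_zero, zero_smul])
  eq_zero_or_eq_zero f g hf hfc hg hgc hfg hsum := by
    have hgf : g * f = 0 := by rw [← Semigroup.mem_center_iff.mp hgc, hfg]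
    have hfe : f * e = f := by rw [← hsum, mul_add, hf.eq, hfg, add_zero]
    have hge : g * e = g := by rw [← hsum, mul_add, hg.eq, hgf, zero_add]
    rcases rationalInclusion_smul_eq_zero_or_eq_self (V := V) hf hfc with h0 | h1
    · exact Or.inl (hfe ▸ h.mul_eq_zero f h0)
    · refine Or.inr (hge ▸ h.mul_eq_zero g fun v => ?_)
      rw [← h1 v, ← mul_smul, ← map_mul, hgf, map_zero, zero_smul]
  exists_smul_ne_zero := by
    have := IsSimpleModule.nontrivial (S.terwilligerAlgebra ℂ x) V
    obtain ⟨v, hv⟩ := exists_ne (0 : V)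
    exact ⟨v, by rwa [h.smul_eq]⟩

theorem IsAnnihilatorComplement.eq_of_isComponentIdempotent
    (h : S.IsAnnihilatorComplement x V e) {e' : S.terwilligerAlgebra ℚ x}
    (h' : S.IsComponentIdempotent x V e') : e' = e := by
  have hc := Semigroup.mem_center_iff.mp h.central
  have hc' := Semigroup.mem_center_iff.mp h'.central
  obtain ⟨v, hv⟩ := h'.exists_smul_ne_zero
  have h1 : ∀ w : V, S.rationalInclusion x e' • w = w :=
    (rationalInclusion_smul_eq_zero_or_eq_self h'.idem h'.central).resolve_left fun h0 => hv (h0 v)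
  have hee' : e' * e = e := by
    have := h.mul_eq_zero (1 - e') fun w => by
      rw [map_sub, map_one, sub_smul, one_smul, h1, sub_self]
    rw [sub_mul, one_mul, sub_eq_zero] at this
    exact this.symm
  have hsub : (e' - e) * (e' - e) = e' - e := by
    rw [sub_mul, mul_sub, mul_sub, h'.idem.eq, hee', hc' e, hee', h.idem.eq, sub_self, sub_zero]
  rcases h'.eq_zero_or_eq_zero e (e' - e) h.idem h.central hsub
    ((Subring.center _).sub_mem h'.central h.central)
    (by rw [mul_sub, hc' e, hee', h.idem.eq, sub_self]) (add_sub_cancel e e') with h0 | h0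
  · exact absurd h0 h.isComponentIdempotent.ne_zero
  · exact sub_eq_zero.mp h0

end Component

section Extension

variable (x : X) (W : Type*) [AddCommGroup W] [Module ℚ W] [Module (S.terwilligerAlgebra ℚ x) W]
  [IsScalarTower ℚ (S.terwilligerAlgebra ℚ x) W]

/-- The pure tensor `z ⊗ w` as an element of the extended module. -/
noncomputable def ComplexExtension.tmul (z : ℂ) (w : W) : S.ComplexExtension x W := z ⊗ₜ[ℚ] w

variable {W}

theorem smul_tmul_eq (c z : ℂ) (a : S.terwilligerAlgebra ℚ x) (w : W) :
    (c • S.rationalInclusion x a) • ComplexExtension.tmul S x W z w =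
      ComplexExtension.tmul S x W (c * z) (a • w) :=
  S.extensionRep_apply x W c z a w

variable (W) in
omit [Module (S.terwilligerAlgebra ℚ x) W] [IsScalarTower ℚ (S.terwilligerAlgebra ℚ x) W] in
theorem ComplexExtension.induction {p : S.ComplexExtension x W → Prop} (zero : p 0)
    (tmul : ∀ z w, p (ComplexExtension.tmul S x W z w)) (add : ∀ m n, p m → p n → p (m + n))
    (m : S.ComplexExtension x W) : p m :=
  TensorProduct.induction_on (R := ℚ) (M := ℂ) (N := W) m zero tmul add

variable {V : Type*} [AddCommGroup V] [Module ℂ V] [Module (S.terwilligerAlgebra ℂ x) V]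
  [IsScalarTower ℂ (S.terwilligerAlgebra ℂ x) V]

theorem exists_extension (g : W →+ V)
    (hg : ∀ (a : S.terwilligerAlgebra ℚ x) w, g (a • w) = S.rationalInclusion x a • g w) :
    ∃ f : S.ComplexExtension x W →ₗ[S.terwilligerAlgebra ℂ x] V,
      ∀ w, f (ComplexExtension.tmul S x W 1 w) = g w := by
  let _ : Module ℚ V := Module.compHom V (algebraMap ℚ ℂ)
  have : IsScalarTower ℚ ℂ V := IsScalarTower.of_algebraMap_smul fun _ _ => rfl
  let f₀ : ℂ ⊗[ℚ] W →ₗ[ℂ] V := g.toRatLinearMap.liftBaseChange ℂ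
  let f₁ : S.ComplexExtension x W →+ V := f₀.toAddMonoidHom
  have hf₁ : ∀ z w, f₁ (ComplexExtension.tmul S x W z w) = z • g w := fun z w =>
    LinearMap.liftBaseChange_tmul ℂ g.toRatLinearMap z w
  refine ⟨{ f₁ with map_smul' := fun t m => ?_ }, fun w => (hf₁ 1 w).trans (one_smul ℂ _)⟩
  change f₁ (t • m) = t • f₁ m
  obtain ⟨t, rfl⟩ := (S.extensionHom_bijective x).2 t
  induction t with
  | zero => simp
  | add s t hs ht => rw [map_add, add_smul, add_smul, map_add, hs, ht]
  | tmul c a =>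
    rw [extensionHom_tmul]
    induction m using ComplexExtension.induction with
    | zero => simp
    | add m n hm hn => rw [smul_add, map_add, map_add, smul_add, hm, hn]
    | tmul z w => rw [smul_tmul_eq, hf₁, hf₁, hg, smul_assoc, smul_comm _ z, smul_smul]

/-- If `W` is simple and `V` is thin, then any two homomorphisms from `ℂ ⊗ W` to `V` are
proportional. -/
theorem IsThin.ker_le_ker (hV : S.IsThin x V) [IsSimpleModule (S.terwilligerAlgebra ℚ x) W]
    {f : S.ComplexExtension x W →ₗ[S.terwilligerAlgebra ℂ x] V} (hf : f ≠ 0)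
    (g : S.ComplexExtension x W →ₗ[S.terwilligerAlgebra ℂ x] V) :
    LinearMap.ker f ≤ LinearMap.ker g := by
  have hE := S.completeOrthogonalIdempotents_dualElement ℚ x
  have := IsSimpleModule.nontrivial (S.terwilligerAlgebra ℚ x) W
  obtain ⟨w₀, hw₀⟩ := exists_ne (0 : W)
  obtain ⟨i, hi⟩ : ∃ i, S.dualElement ℚ x i • w₀ ≠ 0 := by
    by_contra! h
    apply hw₀
    rw [← one_smul (S.terwilligerAlgebra ℚ x) w₀, ← hE.complete, Finset.sum_smul]
    exact Finset.sum_eq_zero fun i _ => h i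
  set w := S.dualElement ℚ x i • w₀ with hw
  have hmem : ∀ h : S.ComplexExtension x W →ₗ[S.terwilligerAlgebra ℂ x] V,
      h (ComplexExtension.tmul S x W 1 w) ∈ S.dualSubspace x V i := by
    intro h
    rw [mem_dualSubspace_iff, ← map_smul, ← rationalInclusion_dualElement,
      ← one_smul ℂ (S.rationalInclusion x _), smul_tmul_eq, one_mul, hw, ← mul_smul,
      (hE.idem i).eq]
  have hgen : ∀ (z : ℂ) (w' : W), ∃ t : S.terwilligerAlgebra ℂ x,
      ∀ h : S.ComplexExtension x W →ₗ[S.terwilligerAlgebra ℂ x] V,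
        h (ComplexExtension.tmul S x W z w') = t • h (ComplexExtension.tmul S x W 1 w) := by
    intro z w'
    obtain ⟨a, rfl⟩ :=
      IsSimpleModule.toSpanSingleton_surjective (S.terwilligerAlgebra ℚ x) hi w'
    refine ⟨z • S.rationalInclusion x a, fun h => ?_⟩
    rw [← map_smul, smul_tmul_eq, mul_one, LinearMap.toSpanSingleton_apply]
  have hf0 : f (ComplexExtension.tmul S x W 1 w) ≠ 0 := by
    intro h0
    refine hf (LinearMap.ext fun m => ?_)
    induction m using ComplexExtension.induction with
    | zero => simp
    | add m n hm hn => rw [map_add, hm, hn, map_add]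
    | tmul z w' =>
      obtain ⟨t, ht⟩ := hgen z w'
      rw [ht, h0, smul_zero, LinearMap.zero_apply]
  obtain ⟨c, hc⟩ := IsThin.exists_smul_eq S x hV (hmem f) hf0 (hmem g)
  have hprop : ∀ m, g m = c • f m := by
    intro m
    induction m using ComplexExtension.induction with
    | zero => simp
    | add m n hm hn => rw [map_add, hm, hn, map_add, smul_add]
    | tmul z w' =>
      obtain ⟨t, ht⟩ := hgen z w'
      rw [ht, ht, ← hc, smul_comm]
  intro m hm
  rw [LinearMap.mem_ker] at hm ⊢
  rw [hprop, hm, smul_zero]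

omit [Module ℚ W] [IsScalarTower ℚ (S.terwilligerAlgebra ℚ x) W] [Module ℂ V]
  [IsScalarTower ℂ (S.terwilligerAlgebra ℂ x) V] in
theorem IsAnnihilatorComplement.exists_semilinear [IsSimpleModule (S.terwilligerAlgebra ℚ x) W]
    {e : S.terwilligerAlgebra ℚ x} (h : S.IsAnnihilatorComplement x V e)
    (he : ∃ w : W, e • w ≠ 0) :
    ∃ g : W →+ V, g ≠ 0 ∧
      ∀ (a : S.terwilligerAlgebra ℚ x) w, g (a • w) = S.rationalInclusion x a • g w := by
  obtain ⟨w, hw⟩ := he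
  have h1 : ∀ w : W, e • w = w :=
    (IsSimpleModule.smul_eq_zero_or_eq_self h.idem h.central).resolve_left fun h0 => hw (h0 w)
  obtain ⟨I, ⟨φ⟩⟩ :=
    IsSemisimpleRing.exists_linearEquiv_ideal_of_isSimpleModule (S.terwilligerAlgebra ℚ x) W
  have hne : (φ w).1 * e ≠ 0 := by
    rw [Semigroup.mem_center_iff.mp h.central]
    change ¬ (e • φ w : I).1 = 0
    rw [← map_smul, h1, ZeroMemClass.coe_eq_zero, map_eq_zero_iff φ φ.injective]
    rwa [h1] at hw
  obtain ⟨v, hv⟩ : ∃ v : V, S.rationalInclusion x (φ w).1 • v ≠ 0 := by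
    by_contra! h0
    exact hne (h.mul_eq_zero _ h0)
  refine ⟨{ toFun := fun w => S.rationalInclusion x (φ w).1 • v, map_zero' := ?_,
            map_add' := fun a b => ?_ }, fun h0 => hv (DFunLike.congr_fun h0 w), fun a w => ?_⟩
  · simp
  · rw [map_add, Submodule.coe_add, map_add, add_smul]
  · change S.rationalInclusion x (φ (a • w)).1 • v = _ • S.rationalInclusion x (φ w).1 • v
    rw [map_smul, Submodule.coe_smul, smul_eq_mul, map_mul, mul_smul]

theorem IsAnnihilatorComplement.multiplicity_eq_one
    [IsSimpleModule (S.terwilligerAlgebra ℂ x) V] (hV : S.IsThin x V)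
    [IsSimpleModule (S.terwilligerAlgebra ℚ x) W]
    {e : S.terwilligerAlgebra ℚ x} (h : S.IsAnnihilatorComplement x V e)
    (he : ∃ w : W, e • w ≠ 0) :
    multiplicity (S.terwilligerAlgebra ℂ x) V (S.ComplexExtension x W) = 1 := by
  obtain ⟨g, hg0, hg⟩ := IsAnnihilatorComplement.exists_semilinear S x h he
  obtain ⟨f, hf⟩ := S.exists_extension x g hg
  have hf0 : f ≠ 0 := by
    rintro rfl
    exact hg0 (AddMonoidHom.ext fun w => (hf w).symm)
  exact length_isotypicComponent_eq_one f hf0 (IsThin.ker_le_ker S x hV hf0)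

end Extension

theorem exists_simple_ideal_smul_ne_zero (x : X) {e : S.terwilligerAlgebra ℚ x}
    (hc : e ∈ Set.center (S.terwilligerAlgebra ℚ x)) (hi : IsIdempotentElem e) (h0 : e ≠ 0) :
    ∃ W : Submodule (S.terwilligerAlgebra ℚ x) (S.terwilligerAlgebra ℚ x),
      IsSimpleModule (S.terwilligerAlgebra ℚ x) W ∧ ∃ w : W, e • w ≠ 0 := by
  obtain ⟨W, hW, hle⟩ := (eq_bot_or_exists_atom_le (Ideal.span {e})).resolve_left
    (by simpa using h0)
  obtain ⟨w, hw, hw0⟩ := (Submodule.ne_bot_iff W).mp hW.1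
  refine ⟨W, isSimpleModule_iff_isAtom.mpr hW, ⟨w, hw⟩, fun h => hw0 ?_⟩
  obtain ⟨b, rfl⟩ := Ideal.mem_span_singleton'.mp (hle hw)
  have h' : e * (b * e) = 0 := congrArg Subtype.val h
  rwa [← Semigroup.mem_center_iff.mp hc, mul_assoc, hi.eq] at h'

theorem IsAnnihilatorComplement.nonempty_corner_algEquiv (x : X) {V : Type*} [AddCommGroup V]
    [Module ℂ V] [Module (S.terwilligerAlgebra ℂ x) V]
    [IsScalarTower ℂ (S.terwilligerAlgebra ℂ x) V] [IsSimpleModule (S.terwilligerAlgebra ℂ x) V]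
    (hV : S.IsThin x V) {e : S.terwilligerAlgebra ℚ x} (h : S.IsAnnihilatorComplement x V e)
    (he : IsIdempotentElem e) :
    Nonempty (he.Corner ≃ₐ[ℚ] Matrix (Fin (S.dualDiameter x V)) (Fin (S.dualDiameter x V))
      (S.characterField x (S.character x V))) := by
  obtain ⟨b, hb⟩ := IsThin.exists_basis S x hV
  let τ := S.matrixRep x b
  have h1 : τ e = 1 := by
    rw [← map_one τ]
    exact (S.matrixRep_eq_iff x b e 1).mpr fun v => by rw [h.smul_eq, map_one, one_smul]
  have hker : ∀ a, τ a = 0 → a * e = 0 := by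
    intro a ha
    rw [← map_zero τ] at ha
    exact h.mul_eq_zero a fun v => by
      rw [(S.matrixRep_eq_iff x b a 0).mp ha v, map_zero, zero_smul]
  have hs : ∀ j, Matrix.single j j (1 : ℂ) ∈ τ.range := by
    intro j
    refine ⟨S.dualElement ℚ x j, ?_⟩
    ext l m
    change S.matrixRep x b _ l m = _
    rw [matrixRep_apply, rationalInclusion_dualElement, hb]
    by_cases hjm : j = m
    · subst hjm
      simp [Finsupp.single_apply, Matrix.single_apply]
    · rw [if_neg fun h' => hjm (Subtype.ext h'),
        Matrix.single_apply_of_ne _ _ _ _ _ fun h' => hjm h'.2]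
      simp
  have hne : ∀ j l, ∃ m ∈ τ.range, m j l ≠ 0 := by
    intro j l
    obtain ⟨a, ha⟩ := S.exists_repr_smul_ne_zero x b j l
    exact ⟨τ a, ⟨a, rfl⟩, by rwa [← S.matrixRep_apply x b] at ha⟩
  have : Module.Finite ℚ τ.range := Module.Finite.range τ.toLinearMap
  obtain ⟨e₁⟩ := he.nonempty_corner_algEquiv_range τ h1 hker
  obtain ⟨e₂⟩ := τ.range.nonempty_algEquiv_matrix_traceField hs hne
  rw [S.traceField_range_matrixRep x b] at e₂
  have hcard : Fintype.card (S.dualSupport x V) = S.dualDiameter x V := by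
    rw [dualDiameter, Set.ncard_eq_toFinset_card', Set.toFinset_card]
  exact ⟨(e₁.trans e₂).trans
    (Matrix.reindexAlgEquiv ℚ _ (Fintype.equivFinOfCardEq hcard))⟩

end AssociationScheme

theorem theorem5p1 {X : Type u} [Fintype X] [DecidableEq X] {d : ℕ}
    (S : AssociationScheme X d) (x : X)
    (V : Type v) [AddCommGroup V] [Module ℂ V] [Module (S.terwilligerAlgebra ℂ x) V]
    [IsScalarTower ℂ (S.terwilligerAlgebra ℂ x) V]
    [IsSimpleModule (S.terwilligerAlgebra ℂ x) V] (hV : S.IsThin x V)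
    (χ : S.terwilligerAlgebra ℂ x →ₗ[ℂ] ℂ) (hχ : χ = S.character x V) :
    AssociationScheme.HasRationalSchurIndex.{u, v, w} S x V 1 ∧
      (∃! e : S.terwilligerAlgebra ℚ x, S.IsComponentIdempotent x V e) ∧
      ∀ (e : S.terwilligerAlgebra ℚ x) (he : S.IsComponentIdempotent x V e),
        Nonempty (he.idem.Corner ≃ₐ[ℚ]
          Matrix (Fin (S.dualDiameter x V)) (Fin (S.dualDiameter x V))
            (S.characterField x χ)) := by
  subst hχ
  obtain ⟨e, he⟩ := S.exists_isAnnihilatorComplement x V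
  have hcomp := he.isComponentIdempotent
  refine ⟨⟨e, hcomp, S.exists_simple_ideal_smul_ne_zero x he.central he.idem hcomp.ne_zero, ?_⟩,
    ⟨e, hcomp, fun e' he' => he.eq_of_isComponentIdempotent he'⟩, fun e' he' => ?_⟩
  · intro W _ _ _ _ _ hW
    exact AssociationScheme.IsAnnihilatorComplement.multiplicity_eq_one S x hV he hW
  · obtain rfl := he.eq_of_isComponentIdempotent he'
    exact AssociationScheme.IsAnnihilatorComplement.nonempty_corner_algEquiv S x hV he he'.idem
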